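/- Let $G=(V,E)$ be a finite undirected graph with edge weights $w\in\mathbb{R}_+^E$, and let $\mathcal{M}$ be a matroid on $V$ of rank $k\ge 1$. The graph coverage function is $f(S)=\sum_{uv\in E:\ \{u,v\}\cap S\ne\emptyset} w(uv)$ and the cut function is $d_w(S)=\sum_{uv\in E:\ |\{u,v\}\cap S|=1} w(uv)$, for $S\subseteq V$. The problem GCov-MCP asks to minimize $f(\mathcal{P})=\sum_{i=1}^k f(V_i)$ over all feasible partitions $\mathcal{P}=\{V_1,\dots,V_k\}$ of $V$, i.e. those for which there is a basis $B$ of $\mathcal{M}$ with $|B\cap V_i|=1$ for all $i$. A Gomory–Hu tree of $d_w$ is a tree $H=(V,F)$ with edge weights $w_H$ such that for all $s\neq t$ in $V$, the minimum of $w_H(e)$ over the edges $e$ of the $s$–$t$ path in $H$ equals $\min\{d_w(S): s\in S\subseteq V\setminus\{t\}\}$, and such that, for any edge $e$ of minimum weight on this path, the two components of $H-e$ are the two sides of such a minimum $s$–$t$ cut. Let $\mathcal{I}'$ be the family of all $X\subseteq F$ for which the connected components of $H-X$ have a transversal that is independent in $\mathcal{M}$. The Gomory–Hu tree algorithm takes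 a Gomory–Hu tree $(H,w_H)$ of $d_w$, starts with $C=\emptyset$, and, while $|C|<k-1$, adds to $C$ an edge $e\in F\setminus C$ of minimum weight $w_H(e)$ among those with $C+e\in\mathcal{I}'$; it returns the partition $\mathcal{P}$ of $V$ into the connected components of $H-C$. **Theorem.** The Gomory–Hu tree algorithm provides a $4/3$-approximation for GCov-MCP. That is: a Gomory–Hu tree of $d_w$ exists; for every Gomory–Hu tree and every way of breaking ties, the loop never gets stuck and stops after at most $k-1$ iterations; and every partition $\mathcal{P}$ that the algorithm can return is feasible and satisfies $f(\mathcal{P})\le\frac43 f(\mathcal{Q})$ for every feasible partition $\mathcal{Q}$. -/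

import Mathlib

/-- The graph coverage function `S ↦ ∑ w(uv)`, summed over the edges `uv` of `G` with
`{u, v} ∩ S ≠ ∅`. -/
noncomputable def graphCoverage {V : Type*} [Fintype V] (G : SimpleGraph V) (w : Sym2 V → ℝ)
    (S : Finset V) : ℝ :=
  open Classical in
  ∑ e ∈ G.edgeFinset with ∃ v ∈ S, v ∈ e, w e

/-- The weighted cut function `S ↦ ∑ w(uv)`, summed over the edges `uv` of `G` leaving `S`, that is,
having one end in `S` and the other one outside `S`. -/
noncomputable def graphCut {V : Type*} [Fintype V] (G : SimpleGraph V) (w : Sym2 V → ℝ)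
    (S : Finset V) : ℝ :=
  open Classical in
  ∑ e ∈ G.edgeFinset with (∃ u ∈ S, u ∈ e) ∧ (∃ v ∉ S, v ∈ e), w e

/-- `f(𝒫) = ∑_{X ∈ 𝒫} f(X)` for a set function `f` and a partition `𝒫` of `V`. -/
def partitionCost {V : Type*} [Fintype V] [DecidableEq V] (f : Finset V → ℝ)
    (P : Finpartition (Finset.univ : Finset V)) : ℝ :=
  ∑ A ∈ P.parts, f A

/-- Feasibility in matroid-constrained partitioning: `P` has exactly `k` classes, and some basis of
`M` meets every class in exactly one element. -/
def IsFeasiblePartition {V : Type*} [Fintype V] [DecidableEq V] (M : Matroid V) (k : ℕ)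
    (P : Finpartition (Finset.univ : Finset V)) : Prop :=
  P.parts.card = k ∧ ∃ B : Set V, M.IsBase B ∧ ∀ A ∈ P.parts, (B ∩ (A : Set V)).ncard = 1

/-- The partition of `V` into the connected components of `G`. -/
noncomputable def componentPartition {V : Type*} [Fintype V] [DecidableEq V] (G : SimpleGraph V) :
    Finpartition (Finset.univ : Finset V) :=
  open Classical in
  Finpartition.ofSetoid G.reachableSetoid

/-- The set of vertices of the connected component of `H - e` that contains `s`. -/
noncomputable def edgeSide {V : Type*} [Fintype V] (H : SimpleGraph V) (e : Sym2 V) (s : V) :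
    Finset V :=
  open Classical in
  Finset.univ.filter fun v => (H.deleteEdges {e}).Reachable s v

/-- The values `f S` of all sets `S` with `s ∈ S ⊆ V - t`. -/
def separatingValues {V : Type*} (f : Finset V → ℝ) (s t : V) : Set ℝ :=
  {x | ∃ S : Finset V, s ∈ S ∧ t ∉ S ∧ f S = x}

/-- `H` with the edge weights `wH` is a Gomory-Hu tree of the set function `f`: `H` is a tree on
`V`, and for distinct `s, t` and the `s`-`t` path `p` of `H`, the minimum weight of an edge of `p`
is the minimum of `f S` over all `S` with `s ∈ S ⊆ V - t`; moreover, deleting an edge of minimum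
weight of `p` from `H` leaves a component containing `s` that attains this minimum. -/
structure IsGomoryHuTree {V : Type*} [Fintype V] (f : Finset V → ℝ) (H : SimpleGraph V)
    (wH : Sym2 V → ℝ) : Prop where
  isTree : H.IsTree
  min_eq : ∀ (s t : V), s ≠ t → ∀ p : H.Walk s t, p.IsPath →
    ∃ m : ℝ, IsLeast {x | ∃ e ∈ p.edges, wH e = x} m ∧ IsLeast (separatingValues f s t) m
  cut_attains : ∀ (s t : V), s ≠ t → ∀ p : H.Walk s t, p.IsPath →
    ∀ e ∈ p.edges, (∀ e' ∈ p.edges, wH e ≤ wH e') →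
      t ∉ edgeSide H e s ∧ IsLeast (separatingValues f s t) (f (edgeSide H e s))

/-- The family of all sets `X` of edges of `H` such that the connected components of `H - X` have a
transversal that is independent in `M`. -/
def transversalFamily {V : Type*} (M : Matroid V) (H : SimpleGraph V) : Set (Finset (Sym2 V)) :=
  {X | (X : Set (Sym2 V)) ⊆ H.edgeSet ∧ ∃ I : Set V, M.Indep I ∧
    ∀ c : (H.deleteEdges (X : Set (Sym2 V))).ConnectedComponent, (I ∩ c.supp).ncard = 1}

/-- The edges that may be added to `C` while staying in the family `transversalFamily M H`. -/
def greedyCandidates {V : Type*} [DecidableEq V] (M : Matroid V) (H : SimpleGraph V)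
    (C : Finset (Sym2 V)) : Set (Sym2 V) :=
  {e | e ∈ H.edgeSet ∧ e ∉ C ∧ insert e C ∈ transversalFamily M H}

/-- `GreedyRun M k H wH n C`: after `n` iterations of the loop
`while |C| < k - 1 do C ← C + argmin {wH e | e ∉ C, C + e ∈ transversalFamily M H}`
started at `C = ∅`, the current set can be `C` (ties may be broken in any way). -/
inductive GreedyRun {V : Type*} [DecidableEq V] (M : Matroid V) (k : ℕ) (H : SimpleGraph V)
    (wH : Sym2 V → ℝ) : ℕ → Finset (Sym2 V) → Prop
  | start : GreedyRun M k H wH 0 ∅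
  | step {n : ℕ} {C : Finset (Sym2 V)} {e : Sym2 V} : GreedyRun M k H wH n C →
      C.card < k - 1 → e ∈ greedyCandidates M H C →
      (∀ e' ∈ greedyCandidates M H C, wH e ≤ wH e') → GreedyRun M k H wH (n + 1) (insert e C)

/-- `P` is a possible output of the Gomory-Hu tree algorithm for the symmetric submodular function
`f` and the rank-`k` matroid `M`: for some Gomory-Hu tree `(H, wH)` of `f`, the greedy loop stops
with a set `C` of edges, and `P` consists of the connected components of `H - C`. -/
def IsGomoryHuOutput {V : Type*} [Fintype V] [DecidableEq V] (f : Finset V → ℝ) (M : Matroid V)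
    (k : ℕ) (P : Finpartition (Finset.univ : Finset V)) : Prop :=
  ∃ (H : SimpleGraph V) (wH : Sym2 V → ℝ), IsGomoryHuTree f H wH ∧
    ∃ (n : ℕ) (C : Finset (Sym2 V)), GreedyRun M k H wH n C ∧ ¬ C.card < k - 1 ∧
      P = componentPartition (H.deleteEdges (C : Set (Sym2 V)))

/-!
Let `W` be the total edge weight of `G`. An edge is covered once or twice by the classes of a
partition `P`, so `f(P) = W + x(P)`, where `x(P)` is the weight of the edges crossing `P`, and the
cut values of the classes add up to `2 x(P)`. The approximation ratio comes from two bounds on the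
output `P` compared with a feasible partition `Q`: trivially `x(P) ≤ W`, and `x(P) ≤ 2 x(Q)`.
Together they give `3 (W + x(P)) ≤ 4 (W + x(Q))`.

For the second bound, every edge crossing `P` lies in the fundamental cut of an edge of the greedy
set `C`, hence `x(P)` is at most the weight of `C` (`crossWeight_componentPartition_le`). It remains
to bound the weight of `C` by the sum of the cut values of the classes of `Q`. Order these classes
by increasing cut value. The tree edges that leave one of the first `j` classes separate `j + 1`
elements of a base, and each of them weighs at most the `j`-th cut value, since the class that it
leaves separates its ends. The augmentation property `exists_mem_greedyCandidates` says that
one of these edges is a candidate in the `j`-th step, so the `j`-th greedy edge is no heavier than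
the `j`-th cut value (`GreedyRun.sum_weight_le`). The augmentation property itself is proved by
choosing, among the independent transversals of the components of `H - C`, one that shares as many
elements as possible with the given larger independent set. It also shows that the loop never gets
stuck.

A Gomory-Hu tree of a symmetric submodular function is built by induction on the number of terminals
(`exists_isCutTree`): a cheapest set `X` that splits the terminals is used as one fundamental
cut, and both sides are treated recursively after contracting the other one. By submodularity, the
cuts found in the contracted instances stay minimal in the original one (`IsCutTree.of_contract`).
-/

/-! ### Deleting edges of a forest -/

namespace SimpleGraph

variable {V : Type*} {G : SimpleGraph V}

/-- Two vertices that become disconnected when the edge `ab` is deleted lie on different sides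
of it. -/
theorem Reachable.deleteEdges_singleton_ends {a b x y : V} (h : G.Reachable x y)
    (hn : ¬ (G.deleteEdges {s(a, b)}).Reachable x y) :
    ((G.deleteEdges {s(a, b)}).Reachable x a ∧ (G.deleteEdges {s(a, b)}).Reachable y b) ∨
    ((G.deleteEdges {s(a, b)}).Reachable x b ∧ (G.deleteEdges {s(a, b)}).Reachable y a) := by
  obtain ⟨p⟩ := h
  induction p with
  | nil => exact absurd (Reachable.refl _) hn
  | @cons x z y hxz q ih =>
    by_cases he : s(x, z) = s(a, b)
    · rw [Sym2.eq_iff] at he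
      by_cases hzy : (G.deleteEdges {s(a, b)}).Reachable z y
      · rcases he with ⟨rfl, rfl⟩ | ⟨rfl, rfl⟩
        · exact Or.inl ⟨Reachable.refl _, hzy.symm⟩
        · exact Or.inr ⟨Reachable.refl _, hzy.symm⟩
      · rcases he with ⟨rfl, rfl⟩ | ⟨rfl, rfl⟩ <;> rcases ih hzy with ⟨h1, h2⟩ | ⟨h1, h2⟩
        · exact absurd (h2.trans h1) (fun h => hn h.symm)
        · exact absurd h2.symm hn
        · exact absurd h2.symm hn
        · exact absurd (h2.trans h1) (fun h => hn h.symm)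
    · have hadj : (G.deleteEdges {s(a, b)}).Adj x z := by
        simp [deleteEdges_adj, hxz, he]
      have hzy : ¬ (G.deleteEdges {s(a, b)}).Reachable z y := fun h => hn (hadj.reachable.trans h)
      rcases ih hzy with ⟨h1, h2⟩ | ⟨h1, h2⟩
      · exact Or.inl ⟨hadj.reachable.trans h1, h2⟩
      · exact Or.inr ⟨hadj.reachable.trans h1, h2⟩

/-- In a forest, deleting an edge of the path between two vertices separates them. -/
theorem IsAcyclic.not_reachable_deleteEdges (hG : G.IsAcyclic) {x y : V} {p : G.Walk x y}
    (hp : p.IsPath) {S : Set (Sym2 V)} {e : Sym2 V} (he : e ∈ p.edges) (heS : e ∈ S) :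
    ¬ (G.deleteEdges S).Reachable x y := by
  rintro ⟨q⟩
  classical
  have hq := (hG.subsingleton_path x y).elim ⟨p, hp⟩
    ⟨q.bypass.mapLe (deleteEdges_le S), q.bypass_isPath.mapLe _⟩
  have hpq : p = q.bypass.mapLe (deleteEdges_le S) := congrArg Subtype.val hq
  rw [hpq, Walk.edges_mapLe_eq_edges] at he
  have := Walk.edges_subset_edgeSet _ he
  rw [edgeSet_deleteEdges] at this
  exact this.2 heS

/-- Two vertices disconnected by deleting `S` are joined by paths that meet `S`. -/
theorem Walk.exists_mem_edges_of_not_reachable {x y : V} (p : G.Walk x y) {S : Set (Sym2 V)}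
    (h : ¬ (G.deleteEdges S).Reachable x y) : ∃ e ∈ p.edges, e ∈ S := by
  by_contra! hc
  exact h ⟨p.toDeleteEdges S hc⟩

/-- Deleting an edge of a forest adds exactly one connected component. -/
theorem IsAcyclic.card_connectedComponent_deleteEdges_singleton [Finite V] (hG : G.IsAcyclic)
    {e : Sym2 V} (he : e ∈ G.edgeSet) :
    Nat.card (G.deleteEdges {e}).ConnectedComponent = Nat.card G.ConnectedComponent + 1 := by
  induction e with | h a b =>
  have hab : G.Adj a b := he
  set G' := G.deleteEdges {s(a, b)} with hG'
  have hn : ¬ G'.Reachable a b :=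
    hG.not_reachable_deleteEdges (p := hab.toWalk) (Walk.IsPath.of_adj hab) (e := s(a, b))
      (by simp) (by simp)
  let φ : {c : G'.ConnectedComponent // c ≠ G'.connectedComponentMk b} → G.ConnectedComponent :=
    fun c => c.1.map (Hom.ofLE (deleteEdges_le _))
  have hφ : Function.Bijective φ := by
    constructor
    · rintro ⟨c, hc⟩ ⟨d, hd⟩ h
      induction c using ConnectedComponent.ind with | h u =>
      induction d using ConnectedComponent.ind with | h v =>
      simp only [ConnectedComponent.eq, ne_eq] at hc hd
      have h : G.Reachable u v := ConnectedComponent.eq.mp h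
      simp only [Subtype.mk.injEq, ConnectedComponent.eq]
      by_contra hcon
      rcases Reachable.deleteEdges_singleton_ends (a := a) (b := b) h hcon with h' | h'
      · exact hd h'.2
      · exact hc h'.1
    · intro c
      induction c using ConnectedComponent.ind with | h v =>
      by_cases hv : G'.Reachable v b
      · refine ⟨⟨G'.connectedComponentMk a, by simpa [ConnectedComponent.eq] using hn⟩, ?_⟩
        exact ConnectedComponent.eq.mpr (hab.reachable.trans (hv.mono (deleteEdges_le _)).symm)
      · refine ⟨⟨G'.connectedComponentMk v, by simpa [ConnectedComponent.eq] using hv⟩, rfl⟩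
  have h1 := Nat.card_congr (Equiv.ofBijective φ hφ)
  classical
  have := Fintype.ofFinite G'.ConnectedComponent
  rw [← h1, Nat.card_eq_fintype_card, Nat.card_eq_fintype_card, Fintype.card_subtype_compl,
    Fintype.card_subtype_eq]
  have : 0 < Fintype.card G'.ConnectedComponent :=
    Fintype.card_pos_iff.mpr ⟨G'.connectedComponentMk b⟩
  omega

/-- Deleting a set `X` of edges of a tree leaves `|X| + 1` connected components. -/
theorem IsTree.card_connectedComponent_deleteEdges [Finite V] (hG : G.IsTree)
    (X : Finset (Sym2 V)) (hX : (X : Set (Sym2 V)) ⊆ G.edgeSet) :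
    Nat.card (G.deleteEdges (X : Set (Sym2 V))).ConnectedComponent = X.card + 1 := by
  classical
  induction X using Finset.induction_on with
  | empty =>
    have := hG.connected.preconnected.subsingleton_connectedComponent
    have := hG.connected.nonempty
    have : Nonempty G.ConnectedComponent := this.map G.connectedComponentMk
    simp
  | @insert e X he ih =>
    rw [Finset.coe_insert, Set.insert_subset_iff] at hX
    have hdel : G.deleteEdges (insert e (X : Set (Sym2 V))) =
        (G.deleteEdges (X : Set (Sym2 V))).deleteEdges {e} := by
      rw [deleteEdges_deleteEdges, Set.union_singleton]
    rw [Finset.coe_insert, hdel,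
      (hG.isAcyclic.anti (deleteEdges_le _)).card_connectedComponent_deleteEdges_singleton,
      ih hX.2, Finset.card_insert_of_notMem he]
    rw [edgeSet_deleteEdges]
    exact ⟨hX.1, by simpa using he⟩

/-- A finite set meets every connected component in exactly one vertex iff it has as many elements
as there are components and its elements are pairwise disconnected. -/
theorem forall_ncard_inter_supp_eq_one_iff [Finite V] (I : Finset V) :
    (∀ c : G.ConnectedComponent, ((I : Set V) ∩ c.supp).ncard = 1) ↔
      I.card = Nat.card G.ConnectedComponent ∧ ∀ x ∈ I, ∀ y ∈ I, G.Reachable x y → x = y := by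
  let g : I → G.ConnectedComponent := fun x => G.connectedComponentMk x
  have h1 : (∀ c : G.ConnectedComponent, ((I : Set V) ∩ c.supp).ncard = 1) ↔
      Function.Bijective g := by
    rw [Function.bijective_iff_existsUnique]
    refine forall_congr' fun c => ?_
    rw [Set.ncard_eq_one]
    constructor
    · rintro ⟨a, ha⟩
      have haI : a ∈ (I : Set V) ∩ c.supp := ha ▸ Set.mem_singleton a
      refine ⟨⟨a, haI.1⟩, haI.2, ?_⟩
      rintro ⟨y, hy⟩ hyc
      have : y ∈ (I : Set V) ∩ c.supp := ⟨hy, hyc⟩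
      rw [ha] at this
      exact Subtype.ext this
    · rintro ⟨⟨a, ha⟩, hac, hu⟩
      refine ⟨a, Set.eq_singleton_iff_unique_mem.mpr ⟨⟨ha, hac⟩, ?_⟩⟩
      rintro y ⟨hy, hyc⟩
      exact congrArg Subtype.val (hu ⟨y, hy⟩ hyc)
  rw [h1, Nat.bijective_iff_injective_and_card, and_comm]
  refine and_congr (by simp) ?_
  constructor
  · intro h x hx y hy hxy
    exact congrArg Subtype.val (@h ⟨x, hx⟩ ⟨y, hy⟩ (ConnectedComponent.eq.mpr hxy))
  · rintro h ⟨x, hx⟩ ⟨y, hy⟩ hxy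
    exact Subtype.ext (h x hx y hy (ConnectedComponent.eq.mp hxy))

end SimpleGraph

/-! ### The exchange property of the transversal family -/

/-- For a tree, membership in the transversal family means that there are `|X| + 1` independent
vertices that are pairwise disconnected in `H - X`. -/
theorem mem_transversalFamily_iff {V : Type*} [Fintype V] {M : Matroid V} {H : SimpleGraph V}
    (hH : H.IsTree) {X : Finset (Sym2 V)} :
    X ∈ transversalFamily M H ↔ (X : Set (Sym2 V)) ⊆ H.edgeSet ∧ ∃ I : Finset V, M.Indep ↑I ∧
      I.card = X.card + 1 ∧
      ∀ x ∈ I, ∀ y ∈ I, (H.deleteEdges (X : Set (Sym2 V))).Reachable x y → x = y := by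
  refine and_congr_right fun hX => ?_
  rw [← hH.card_connectedComponent_deleteEdges X hX]
  constructor
  · rintro ⟨I, hI, h⟩
    lift I to Finset V using I.toFinite
    exact ⟨I, hI, (SimpleGraph.forall_ncard_inter_supp_eq_one_iff I).mp h⟩
  · rintro ⟨I, hI, h⟩
    exact ⟨I, hI, (SimpleGraph.forall_ncard_inter_supp_eq_one_iff I).mpr h⟩

/-- Augmentation: if an independent set `J` has more than `|C| + 1` vertices and deleting `Y`
separates all of them, then some edge of `Y` can be added to `C`. Applied to a base it shows that
the greedy loop does not get stuck; applied to representatives of a partition it bounds the weight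
of the greedy edge. -/
theorem exists_mem_greedyCandidates {V : Type*} [Fintype V] [DecidableEq V] {M : Matroid V}
    {H : SimpleGraph V} (hH : H.IsTree) {C : Finset (Sym2 V)} (hC : C ∈ transversalFamily M H)
    {Y : Set (Sym2 V)} {J : Finset V} (hJ : M.Indep ↑J) (hcard : C.card + 1 < J.card)
    (hsep : ∀ x ∈ J, ∀ y ∈ J, (H.deleteEdges Y).Reachable x y → x = y) :
    ∃ e ∈ Y, e ∈ greedyCandidates M H C := by
  classical
  rw [mem_transversalFamily_iff hH] at hC
  obtain ⟨hCH, hC⟩ := hC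
  set G := H.deleteEdges (C : Set (Sym2 V)) with hG
  have hGac : G.IsAcyclic := hH.isAcyclic.anti (SimpleGraph.deleteEdges_le _)
  -- Among the independent transversals of `H - C`, take one that shares most vertices with `J`.
  obtain ⟨I, hI, hmax⟩ := Finset.exists_max_image
    (Finset.univ.filter fun I : Finset V => M.Indep ↑I ∧ I.card = C.card + 1 ∧
      ∀ x ∈ I, ∀ y ∈ I, G.Reachable x y → x = y) (fun I => (I ∩ J).card)
    (by obtain ⟨I, hI⟩ := hC; exact ⟨I, by simpa using hI⟩)
  simp only [Finset.mem_filter, Finset.mem_univ, true_and] at hI hmax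
  obtain ⟨hIind, hIcard, hIinj⟩ := hI
  obtain ⟨y, hyJ, hyI, hyind⟩ := hIind.augment_finset hJ (by omega)
  -- `x` is the vertex of the transversal in the component of `y`.
  obtain ⟨x, hxI, hxy⟩ : ∃ x ∈ I, G.Reachable x y := by
    have := (SimpleGraph.forall_ncard_inter_supp_eq_one_iff (G := G) I).mpr
      ⟨by rw [hIcard, hH.card_connectedComponent_deleteEdges C hCH], hIinj⟩
      (G.connectedComponentMk y)
    obtain ⟨x, hx⟩ := Set.ncard_eq_one.mp this
    have hx' : x ∈ (I : Set V) ∩ (G.connectedComponentMk y).supp := hx ▸ Set.mem_singleton x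
    exact ⟨x, hx'.1, SimpleGraph.ConnectedComponent.eq.mp hx'.2⟩
  obtain ⟨p, hp⟩ := hxy.exists_isPath
  by_cases hpY : ∃ e ∈ p.edges, e ∈ Y
  · obtain ⟨e, hep, heY⟩ := hpY
    have heG := SimpleGraph.Walk.edges_subset_edgeSet _ hep
    rw [hG, SimpleGraph.edgeSet_deleteEdges] at heG
    have heC : e ∉ C := by simpa using heG.2
    refine ⟨e, heY, heG.1, heC, (mem_transversalFamily_iff hH).mpr ⟨?_, insert y I, by
      simpa using hyind, ?_, ?_⟩⟩
    · rw [Finset.coe_insert, Set.insert_subset_iff]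
      exact ⟨heG.1, hCH⟩
    · rw [Finset.card_insert_of_notMem hyI, Finset.card_insert_of_notMem heC, hIcard]
    · have hdel : H.deleteEdges ((insert e C : Finset (Sym2 V)) : Set (Sym2 V)) =
          G.deleteEdges {e} := by
        rw [hG, SimpleGraph.deleteEdges_deleteEdges, Set.union_singleton, Finset.coe_insert]
      rw [hdel]
      have hle : G.deleteEdges {e} ≤ G := SimpleGraph.deleteEdges_le _
      have hnot : ¬ (G.deleteEdges {e}).Reachable x y :=
        hGac.not_reachable_deleteEdges hp hep rfl
      have key : ∀ z ∈ I, ¬ (G.deleteEdges {e}).Reachable z y := by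
        intro z hz hzy
        have : z = x := hIinj z hz x hxI ((hzy.mono hle).trans hxy.symm)
        exact hnot (this ▸ hzy)
      intro a ha b hb hab
      rw [Finset.mem_insert] at ha hb
      rcases ha with rfl | ha <;> rcases hb with rfl | hb
      · rfl
      · exact absurd hab.symm (key b hb)
      · exact absurd hab (key a ha)
      · exact hIinj a ha b hb (hab.mono hle)
  · -- Otherwise exchanging `x` for `y` gives a transversal with a larger intersection with `J`.
    exfalso
    have hxyY : (H.deleteEdges Y).Reachable x y := by
      push Not at hpY
      have hle : G ≤ H := SimpleGraph.deleteEdges_le _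
      exact ⟨(p.mapLe hle).toDeleteEdges Y (by
        rw [SimpleGraph.Walk.edges_mapLe_eq_edges]; exact hpY)⟩
    have hne : x ≠ y := fun h => hyI (h ▸ hxI)
    have hxJ : x ∉ J := fun hxJ => hne (hsep x hxJ y hyJ hxyY)
    have hyIx : y ∉ I.erase x := fun h => hyI (Finset.mem_of_mem_erase h)
    have key : ∀ z ∈ I.erase x, ¬ G.Reachable z y := by
      intro z hz hzy
      exact Finset.ne_of_mem_erase hz
        (hIinj z (Finset.mem_of_mem_erase hz) x hxI (hzy.trans hxy.symm))
    have := hmax (insert y (I.erase x)) ⟨hyind.subset ?_, ?_, ?_⟩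
    · have hlt : I ∩ J ⊂ insert y (I.erase x) ∩ J := by
        rw [Finset.ssubset_iff]
        refine ⟨y, by simp [hyI], ?_⟩
        intro z hz
        rw [Finset.mem_insert, Finset.mem_inter] at hz
        rcases hz with rfl | ⟨hzI, hzJ⟩
        · simp [hyJ]
        · have : z ≠ x := fun h => hxJ (h ▸ hzJ)
          simp [hzI, hzJ, this]
      exact absurd (Finset.card_lt_card hlt) (not_lt.mpr this)
    · rw [Finset.coe_insert]
      exact Set.insert_subset_insert (by simp)
    · have : 0 < I.card := Finset.card_pos.mpr ⟨x, hxI⟩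
      rw [Finset.card_insert_of_notMem hyIx, Finset.card_erase_of_mem hxI]
      omega
    · intro a ha b hb hab
      rw [Finset.mem_insert] at ha hb
      rcases ha with rfl | ha <;> rcases hb with rfl | hb
      · rfl
      · exact absurd hab.symm (key b hb)
      · exact absurd hab (key a ha)
      · exact hIinj a (Finset.mem_of_mem_erase ha) b (Finset.mem_of_mem_erase hb) hab

/-! ### Existence of Gomory-Hu trees -/

/-- A tree `T` on the terminal set `R` is a cut tree of `f` relative to the family `L` of sets:
`side u v` is the side of `u` of the fundamental cut of the edge `uv`, as a subset of the whole
ground set. These sides belong to `L` and have minimum `f`-value among the members of `L` that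
contain `u` and not `v`; no other edge of `T` crosses them; and each element of the ground set is
represented by a terminal that lies in the same sides. -/
structure IsCutTree {V : Type*} (f : Finset V → ℝ) (R : Finset V) (L : Set (Finset V))
    (T : SimpleGraph V) (side : V → V → Finset V) : Prop where
  mem : ∀ {u v}, T.Adj u v → u ∈ R
  conn : ∀ {u v}, u ∈ R → v ∈ R → T.Reachable u v
  side_mem : ∀ {u v}, T.Adj u v → side u v ∈ L
  left_mem : ∀ {u v}, T.Adj u v → u ∈ side u v
  right_notMem : ∀ {u v}, T.Adj u v → v ∉ side u v
  not_cross : ∀ {u v x y}, T.Adj u v → T.Adj x y → s(x, y) ≠ s(u, v) →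
    x ∈ side u v → y ∈ side u v
  side_le : ∀ {u v S}, T.Adj u v → S ∈ L → u ∈ S → v ∉ S → f (side u v) ≤ f S
  exists_rep : ∀ x, ∃ r ∈ R, ∀ {u v}, T.Adj u v → (r ∈ side u v ↔ x ∈ side u v)

/-- The sides of a cut tree are closed under the edges of the tree other than the one they
belong to. -/
theorem IsCutTree.mem_side_of_reachable {V : Type*} {f : Finset V → ℝ} {R : Finset V}
    {L : Set (Finset V)} {T : SimpleGraph V} {side : V → V → Finset V}
    (h : IsCutTree f R L T side) {u v x y : V} (huv : T.Adj u v)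
    (hxy : (T.deleteEdges {s(u, v)}).Reachable x y) (hx : x ∈ side u v) : y ∈ side u v := by
  obtain ⟨p⟩ := hxy
  induction p with
  | nil => exact hx
  | cons hadj q ih =>
    rw [SimpleGraph.deleteEdges_adj] at hadj
    exact ih (h.not_cross huv hadj.1 hadj.2 hx)

theorem mem_edgeSide {V : Type*} [Fintype V] {H : SimpleGraph V} {e : Sym2 V} {s v : V} :
    v ∈ edgeSide H e s ↔ (H.deleteEdges {e}).Reachable s v := by
  simp [edgeSide]

section CutTree

variable {V : Type*} [Fintype V] [DecidableEq V] {f : Finset V → ℝ}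

/-- Uncrossing: let `X` minimize `f` among the members of `L` that split `R`. A cut tree of `R ∩ X`
relative to the members of `L` that do not cut the complement of `X` is also a cut tree relative
to `L`. -/
theorem IsCutTree.of_contract (hsymm : ∀ S, f Sᶜ = f S)
    (hsub : ∀ S T, f (S ∩ T) + f (S ∪ T) ≤ f S + f T) {R X : Finset V} {L : Set (Finset V)}
    (hcompl : ∀ S ∈ L, Sᶜ ∈ L) (hinter : ∀ S ∈ L, ∀ T ∈ L, S ∩ T ∈ L) (hXL : X ∈ L)
    (hXR : ∃ u ∈ R, u ∈ X) (hRX : ∃ v ∈ R, v ∉ X)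
    (hmin : ∀ S ∈ L, (∃ u ∈ R, u ∈ S) → (∃ v ∈ R, v ∉ S) → f X ≤ f S)
    {T : SimpleGraph V} {side : V → V → Finset V}
    (h : IsCutTree f (R ∩ X) {S ∈ L | ∀ x y, x ∉ X → y ∉ X → x ∈ S → y ∈ S} T side) :
    IsCutTree f (R ∩ X) L T side where
  mem := h.mem
  conn := h.conn
  side_mem huv := (h.side_mem huv).1
  left_mem := h.left_mem
  right_notMem := h.right_notMem
  not_cross := h.not_cross
  exists_rep := h.exists_rep
  side_le := by
    intro u v S huv hS hu hv
    have hunion : ∀ S ∈ L, S ∪ X ∈ L := by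
      intro S hS
      have := hcompl _ (hinter _ (hcompl _ hS) _ (hcompl _ hXL))
      rwa [Finset.compl_inter, compl_compl, compl_compl] at this
    -- If a terminal lies outside `S ∪ X`, then intersecting with `X` does not increase `f`.
    have key : ∀ S ∈ L, (∃ r ∈ R, r ∉ S ∧ r ∉ X) → f (S ∩ X) ≤ f S := by
      rintro S hS ⟨r, hr, hrS, hrX⟩
      have h1 := hmin (S ∪ X) (hunion S hS) (by
        obtain ⟨a, ha, haX⟩ := hXR
        exact ⟨a, ha, Finset.mem_union_right _ haX⟩) ⟨r, hr, by simp [hrS, hrX]⟩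
      linarith [hsub S X]
    have huX := (Finset.mem_inter.mp (h.mem huv)).2
    have hvX := (Finset.mem_inter.mp (h.mem huv.symm)).2
    by_cases hr : ∃ r ∈ R, r ∉ S ∧ r ∉ X
    · refine (h.side_le huv ⟨hinter S hS X hXL, ?_⟩ (by simp [hu, huX]) (by simp [hv])).trans
        (key S hS hr)
      intro x y hx _ hxS
      simp [hx] at hxS
    · obtain ⟨r, hr1, hr2⟩ := hRX
      have hrS : r ∈ S := by
        by_contra hrS
        exact hr ⟨r, hr1, hrS, hr2⟩
      have h1 := key Sᶜ (hcompl S hS) ⟨r, hr1, by simpa using hrS, hr2⟩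
      rw [hsymm] at h1
      rw [← hsymm (Sᶜ ∩ X)] at h1
      refine (h.side_le huv ⟨hcompl _ (hinter _ (hcompl S hS) X hXL), ?_⟩ (by simp [hu])
        (by simp [hv, hvX])).trans h1
      intro x y _ hy _
      simp [hy]

/-- Cut trees of the two sides of a set `X` that minimizes `f` among the sets splitting `R` are
joined by an edge between the representatives of the contracted sides. -/
theorem IsCutTree.glue (hsymm : ∀ S, f Sᶜ = f S) {R X : Finset V} {L : Set (Finset V)}
    (hcompl : ∀ S ∈ L, Sᶜ ∈ L) (hXL : X ∈ L)
    (hXR : ∃ u ∈ R, u ∈ X) (hRX : ∃ v ∈ R, v ∉ X)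
    (hmin : ∀ S ∈ L, (∃ u ∈ R, u ∈ S) → (∃ v ∈ R, v ∉ S) → f X ≤ f S)
    {T₁ T₂ : SimpleGraph V} {side₁ side₂ : V → V → Finset V}
    (h₁ : IsCutTree f (R ∩ X) L T₁ side₁)
    (hs₁ : ∀ {u v}, T₁.Adj u v → ∀ x y, x ∉ X → y ∉ X → x ∈ side₁ u v → y ∈ side₁ u v)
    (h₂ : IsCutTree f (R ∩ Xᶜ) L T₂ side₂)
    (hs₂ : ∀ {u v}, T₂.Adj u v → ∀ x y, x ∈ X → y ∈ X → x ∈ side₂ u v → y ∈ side₂ u v) :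
    ∃ T side, IsCutTree f R L T side := by
  obtain ⟨a, haR, haX⟩ := hXR
  obtain ⟨b, hbR, hbX⟩ := hRX
  obtain ⟨r₁, hr₁, hrep₁⟩ := h₁.exists_rep b
  obtain ⟨r₂, hr₂, hrep₂⟩ := h₂.exists_rep a
  rw [Finset.mem_inter] at hr₁ hr₂
  rw [Finset.mem_compl] at hr₂
  have hX₁ : ∀ {u v}, T₁.Adj u v → u ∈ R ∧ u ∈ X := fun h => by simpa using h₁.mem h
  have hX₂ : ∀ {u v}, T₂.Adj u v → u ∈ R ∧ u ∉ X := fun h => by simpa using h₂.mem h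
  let T : SimpleGraph V :=
    { Adj := fun x y => T₁.Adj x y ∨ T₂.Adj x y ∨ (x = r₁ ∧ y = r₂) ∨ (x = r₂ ∧ y = r₁)
      symm := ⟨by
        rintro x y (h | h | h | h)
        · exact Or.inl h.symm
        · exact Or.inr (Or.inl h.symm)
        · exact Or.inr (Or.inr (Or.inr h.symm))
        · exact Or.inr (Or.inr (Or.inl h.symm))⟩
      loopless := ⟨by
        rintro x (h | h | ⟨rfl, h⟩ | ⟨rfl, h⟩)
        · exact h.ne rfl
        · exact h.ne rfl
        · exact hr₂.2 (h ▸ hr₁.2)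
        · exact hr₂.2 (h ▸ hr₁.2)⟩ }
  let side : V → V → Finset V := fun u v =>
    if u ∈ X then (if v ∈ X then side₁ u v else X) else (if v ∈ X then Xᶜ else side₂ u v)
  have hside₁ : ∀ {u v}, T₁.Adj u v → side u v = side₁ u v := fun h => by
    simp [side, (hX₁ h).2, (hX₁ h.symm).2]
  have hside₂ : ∀ {u v}, T₂.Adj u v → side u v = side₂ u v := fun h => by
    simp [side, (hX₂ h).2, (hX₂ h.symm).2]
  have hside₁₂ : side r₁ r₂ = X := by simp [side, hr₁.2, hr₂.2]
  have hside₂₁ : side r₂ r₁ = Xᶜ := by simp [side, hr₁.2, hr₂.2]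
  have hle₁ : T₁ ≤ T := fun _ _ h => Or.inl h
  have hle₂ : T₂ ≤ T := fun _ _ h => Or.inr (Or.inl h)
  have hadj : T.Adj r₁ r₂ := Or.inr (Or.inr (Or.inl ⟨rfl, rfl⟩))
  have hreach : ∀ u ∈ R, T.Reachable r₁ u := by
    intro u hu
    by_cases huX : u ∈ X
    · exact (h₁.conn (by simp [hr₁]) (by simp [hu, huX])).mono hle₁
    · exact hadj.reachable.trans ((h₂.conn (by simp [hr₂]) (by simp [hu, huX])).mono hle₂)
  have hrepr₁ : ∀ {u v}, T₁.Adj u v → ∀ {y}, y ∉ X → (y ∈ side₁ u v ↔ r₁ ∈ side₁ u v) := by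
    intro u v huv y hy
    rw [hrep₁ huv]
    exact ⟨hs₁ huv y b hy hbX, hs₁ huv b y hbX hy⟩
  have hrepr₂ : ∀ {u v}, T₂.Adj u v → ∀ {y}, y ∈ X → (y ∈ side₂ u v ↔ r₂ ∈ side₂ u v) := by
    intro u v huv y hy
    rw [hrep₂ huv]
    exact ⟨hs₂ huv y a hy haX, hs₂ huv a y haX hy⟩
  refine ⟨T, side, ?_, ?_, ?_, ?_, ?_, ?_, ?_, ?_⟩
  · rintro u v (h | h | ⟨rfl, rfl⟩ | ⟨rfl, rfl⟩)
    exacts [(hX₁ h).1, (hX₂ h).1, hr₁.1, hr₂.1]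
  · intro u v hu hv
    exact (hreach u hu).symm.trans (hreach v hv)
  · rintro u v (h | h | ⟨rfl, rfl⟩ | ⟨rfl, rfl⟩)
    · rw [hside₁ h]; exact h₁.side_mem h
    · rw [hside₂ h]; exact h₂.side_mem h
    · rw [hside₁₂]; exact hXL
    · rw [hside₂₁]; exact hcompl X hXL
  · rintro u v (h | h | ⟨rfl, rfl⟩ | ⟨rfl, rfl⟩)
    · rw [hside₁ h]; exact h₁.left_mem h
    · rw [hside₂ h]; exact h₂.left_mem h
    · rw [hside₁₂]; exact hr₁.2
    · rw [hside₂₁]; simpa using hr₂.2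
  · rintro u v (h | h | ⟨rfl, rfl⟩ | ⟨rfl, rfl⟩)
    · rw [hside₁ h]; exact h₁.right_notMem h
    · rw [hside₂ h]; exact h₂.right_notMem h
    · rw [hside₁₂]; exact hr₂.2
    · rw [hside₂₁]; simpa using hr₁.2
  · rintro u v x y (huv | huv | ⟨rfl, rfl⟩ | ⟨rfl, rfl⟩) (hxy | hxy | ⟨rfl, rfl⟩ | ⟨rfl, rfl⟩) hne
    · rw [hside₁ huv]; exact h₁.not_cross huv hxy hne
    · rw [hside₁ huv]; exact hs₁ huv x y (hX₂ hxy).2 (hX₂ hxy.symm).2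
    · rw [hside₁ huv]; exact (hrepr₁ huv hr₂.2).mpr
    · rw [hside₁ huv]; exact (hrepr₁ huv hr₂.2).mp
    · rw [hside₂ huv]; exact hs₂ huv x y (hX₁ hxy).2 (hX₁ hxy.symm).2
    · rw [hside₂ huv]; exact h₂.not_cross huv hxy hne
    · rw [hside₂ huv]; exact (hrepr₂ huv hr₁.2).mp
    · rw [hside₂ huv]; exact (hrepr₂ huv hr₁.2).mpr
    · rw [hside₁₂]; exact fun _ => (hX₁ hxy.symm).2
    · rw [hside₁₂]; exact fun h => absurd h (hX₂ hxy).2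
    · exact absurd rfl hne
    · exact absurd Sym2.eq_swap hne
    · rw [hside₂₁]; exact fun h => absurd (hX₁ hxy).2 (Finset.mem_compl.mp h)
    · rw [hside₂₁]; exact fun _ => Finset.mem_compl.mpr (hX₂ hxy.symm).2
    · exact absurd Sym2.eq_swap hne
    · exact absurd rfl hne
  · rintro u v S (h | h | ⟨rfl, rfl⟩ | ⟨rfl, rfl⟩) hS hu hv
    · rw [hside₁ h]; exact h₁.side_le h hS hu hv
    · rw [hside₂ h]; exact h₂.side_le h hS hu hv
    · rw [hside₁₂]; exact hmin S hS ⟨_, hr₁.1, hu⟩ ⟨_, hr₂.1, hv⟩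
    · rw [hside₂₁, hsymm]; exact hmin S hS ⟨_, hr₂.1, hu⟩ ⟨_, hr₁.1, hv⟩
  · intro x
    by_cases hx : x ∈ X
    · obtain ⟨r, hr, hrep⟩ := h₁.exists_rep x
      rw [Finset.mem_inter] at hr
      refine ⟨r, hr.1, ?_⟩
      rintro u v (h | h | ⟨rfl, rfl⟩ | ⟨rfl, rfl⟩)
      · rw [hside₁ h]; exact hrep h
      · rw [hside₂ h, hrepr₂ h hr.2, hrepr₂ h hx]
      · rw [hside₁₂]; simp [hr.2, hx]
      · rw [hside₂₁]; simp [hr.2, hx]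
    · obtain ⟨r, hr, hrep⟩ := h₂.exists_rep x
      rw [Finset.mem_inter, Finset.mem_compl] at hr
      refine ⟨r, hr.1, ?_⟩
      rintro u v (h | h | ⟨rfl, rfl⟩ | ⟨rfl, rfl⟩)
      · rw [hside₁ h, hrepr₁ h hr.2, hrepr₁ h hx]
      · rw [hside₂ h]; exact hrep h
      · rw [hside₁₂]; simp [hr.2, hx]
      · rw [hside₂₁]; simp [hr.2, hx]

/-- A symmetric submodular function has a cut tree for each nonempty set `R` of terminals that are
pairwise separated by the members of a Boolean algebra `L` of sets. The algebra plays the role of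
the vertex set of a contracted graph: contracting a set means restricting to the members of `L`
that do not cut it. -/
theorem exists_isCutTree (hsymm : ∀ S, f Sᶜ = f S)
    (hsub : ∀ S T, f (S ∩ T) + f (S ∪ T) ≤ f S + f T) (n : ℕ) :
    ∀ (R : Finset V) (L : Set (Finset V)), R.card = n → R.Nonempty → (∀ S ∈ L, Sᶜ ∈ L) →
      (∀ S ∈ L, ∀ T ∈ L, S ∩ T ∈ L) → (∀ u ∈ R, ∀ v ∈ R, u ≠ v → ∃ S ∈ L, u ∈ S ∧ v ∉ S) →
      ∃ T side, IsCutTree f R L T side := by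
  classical
  induction n using Nat.strong_induction_on with | _ n ih =>
  intro R L hn hR hcompl hinter hsep
  by_cases h1 : ∀ u ∈ R, ∀ v ∈ R, u = v
  · obtain ⟨r, hr⟩ := hR
    refine ⟨⊥, fun _ _ => ∅, ⟨?_, ?_, ?_, ?_, ?_, ?_, ?_, ?_⟩⟩
    · exact fun h => absurd h (by simp)
    · intro u v hu hv
      rw [h1 u hu v hv]
    · exact fun h => absurd h (by simp)
    · exact fun h => absurd h (by simp)
    · exact fun h => absurd h (by simp)
    · exact fun h => absurd h (by simp)
    · exact fun h => absurd h (by simp)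
    · exact fun x => ⟨r, hr, fun h => absurd h (by simp)⟩
  · push Not at h1
    obtain ⟨u, hu, v, hv, huv⟩ := h1
    obtain ⟨X, hX, hXmin⟩ := Finset.exists_min_image
      (Finset.univ.filter fun S : Finset V => S ∈ L ∧ (∃ u ∈ R, u ∈ S) ∧ ∃ v ∈ R, v ∉ S) f
      (by
        obtain ⟨S, hS, huS, hvS⟩ := hsep u hu v hv huv
        exact ⟨S, by simpa using ⟨hS, ⟨u, hu, huS⟩, v, hv, hvS⟩⟩)
    simp only [Finset.mem_filter, Finset.mem_univ, true_and] at hX hXmin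
    obtain ⟨hXL, hXR, hRX⟩ := hX
    have hmin : ∀ S ∈ L, (∃ u ∈ R, u ∈ S) → (∃ v ∈ R, v ∉ S) → f X ≤ f S :=
      fun S h1 h2 h3 => hXmin S ⟨h1, h2, h3⟩
    -- The cut tree of one side of a minimizer, obtained by contracting the other side.
    have half : ∀ X ∈ L, (∃ u ∈ R, u ∈ X) → (∃ v ∈ R, v ∉ X) →
        (∀ S ∈ L, (∃ u ∈ R, u ∈ S) → (∃ v ∈ R, v ∉ S) → f X ≤ f S) →
        ∃ T side, IsCutTree f (R ∩ X) {S ∈ L | ∀ x y, x ∉ X → y ∉ X → x ∈ S → y ∈ S} T side := by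
      rintro X hXL ⟨a, haR, haX⟩ ⟨b, hbR, hbX⟩ hmin
      refine ih (R ∩ X).card ?_ _ _ rfl ⟨a, by simp [haR, haX]⟩ ?_ ?_ ?_
      · rw [← hn]
        refine Finset.card_lt_card (Finset.ssubset_iff_subset_ne.mpr ⟨Finset.inter_subset_left, ?_⟩)
        intro h
        rw [← h] at hbR
        exact hbX (Finset.mem_inter.mp hbR).2
      · rintro S ⟨hS, hS'⟩
        refine ⟨hcompl S hS, fun x y hx hy hxS => ?_⟩
        rw [Finset.mem_compl] at hxS ⊢
        exact fun hyS => hxS (hS' y x hy hx hyS)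
      · rintro S ⟨hS, hS'⟩ T ⟨hT, hT'⟩
        refine ⟨hinter S hS T hT, fun x y hx hy hxS => ?_⟩
        rw [Finset.mem_inter] at hxS ⊢
        exact ⟨hS' x y hx hy hxS.1, hT' x y hx hy hxS.2⟩
      · intro u hu v hv huv
        rw [Finset.mem_inter] at hu hv
        obtain ⟨S, hS, huS, hvS⟩ := hsep u hu.1 v hv.1 huv
        refine ⟨S ∩ X, ⟨hinter S hS X hXL, fun x y hx hy hxS => ?_⟩, by simp [huS, hu.2],
          by simp [hvS]⟩
        exact absurd (Finset.mem_inter.mp hxS).2 hx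
    have hXR' : ∃ v ∈ R, v ∉ Xᶜ := by simpa using hXR
    have hRX' : ∃ v ∈ R, v ∈ Xᶜ := by simpa using hRX
    have hmin' : ∀ S ∈ L, (∃ u ∈ R, u ∈ S) → (∃ v ∈ R, v ∉ S) → f Xᶜ ≤ f S := by
      rwa [hsymm]
    obtain ⟨T₁, side₁, h₁⟩ := half X hXL hXR hRX hmin
    obtain ⟨T₂, side₂, h₂⟩ := half Xᶜ (hcompl X hXL) hRX' hXR' hmin'
    refine IsCutTree.glue hsymm hcompl hXL hXR hRX hmin
      (h₁.of_contract hsymm hsub hcompl hinter hXL hXR hRX hmin)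
      (fun huv => (h₁.side_mem huv).2)
      (h₂.of_contract hsymm hsub hcompl hinter (hcompl X hXL) hRX' hXR' hmin')
      (fun huv x y hx hy => (h₂.side_mem huv).2 x y (by simpa using hx) (by simpa using hy))

/-- A symmetric submodular function on a finite nonempty ground set has a Gomory-Hu tree. -/
theorem exists_isGomoryHuTree [Nonempty V] (hsymm : ∀ S, f Sᶜ = f S)
    (hsub : ∀ S T, f (S ∩ T) + f (S ∪ T) ≤ f S + f T) :
    ∃ (H : SimpleGraph V) (wH : Sym2 V → ℝ), IsGomoryHuTree f H wH := by
  classical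
  obtain ⟨H, side, h⟩ := exists_isCutTree hsymm hsub _ Finset.univ Set.univ rfl
    Finset.univ_nonempty (fun _ _ => trivial) (fun _ _ _ _ => trivial)
    (fun u _ v _ huv => ⟨{u}, trivial, by simp, by simpa using huv.symm⟩)
  have hconn : H.Connected :=
    ⟨fun u v => h.conn (Finset.mem_univ _) (Finset.mem_univ _)⟩
  have hbr : ∀ {u v}, H.Adj u v → ¬ (H.deleteEdges {s(u, v)}).Reachable u v := fun huv hr =>
    h.right_notMem huv (h.mem_side_of_reachable huv hr (h.left_mem huv))
  have htree : H.IsTree :=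
    ⟨hconn, SimpleGraph.isAcyclic_iff_forall_adj_isBridge.mpr fun u v huv => by
      rw [SimpleGraph.isBridge_iff]
      exact hbr huv⟩
  have hedge : ∀ {u v}, H.Adj u v → edgeSide H s(u, v) u = side u v := by
    intro u v huv
    ext x
    rw [mem_edgeSide]
    refine ⟨fun hr => h.mem_side_of_reachable huv hr (h.left_mem huv), fun hx => ?_⟩
    by_contra hn
    rcases (hconn.preconnected u x).deleteEdges_singleton_ends (a := u) (b := v) hn with h' | h'
    · exact h.right_notMem huv (h.mem_side_of_reachable huv h'.2 hx)
    · exact hn h'.2.symm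
  have hswap : ∀ {u v}, H.Adj u v → f (side v u) ≤ f (side u v) := by
    intro u v huv
    rw [← hsymm (side u v)]
    exact h.side_le huv.symm trivial (by simpa using h.right_notMem huv)
      (by simpa using h.left_mem huv)
  -- The two sides of an edge have the same value; the maximum makes the definition symmetric.
  let wH : Sym2 V → ℝ := Sym2.lift ⟨fun u v => max (f (side u v)) (f (side v u)),
    fun u v => max_comm _ _⟩
  have hwH : ∀ {u v}, H.Adj u v → wH s(u, v) = f (side u v) := fun huv =>
    max_eq_left (hswap huv)
  have hcut : ∀ {s t : V} {p : H.Walk s t}, p.IsPath → ∀ e ∈ p.edges,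
      t ∉ edgeSide H e s ∧ f (edgeSide H e s) = wH e := by
    intro s t p hp e he
    refine ⟨fun hmem => htree.isAcyclic.not_reachable_deleteEdges hp he (Set.mem_singleton e)
      (mem_edgeSide.mp hmem), ?_⟩
    have heH := p.edges_subset_edgeSet he
    induction e with | h u v =>
    have huv : H.Adj u v := heH
    have hst := htree.isAcyclic.not_reachable_deleteEdges hp he (Set.mem_singleton s(u, v))
    have heq : ∀ {a}, (H.deleteEdges {s(u, v)}).Reachable s a →
        edgeSide H s(u, v) s = edgeSide H s(u, v) a := by
      intro a ha
      ext x
      rw [mem_edgeSide, mem_edgeSide]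
      exact ⟨ha.symm.trans, ha.trans⟩
    rcases (hconn.preconnected s t).deleteEdges_singleton_ends hst with h' | h'
    · rw [heq h'.1, hedge huv, hwH huv]
    · rw [heq h'.1, Sym2.eq_swap, hedge huv.symm, hwH huv.symm]
  have hlower : ∀ {s t : V} (p : H.Walk s t) (S : Finset V), s ∈ S → t ∉ S →
      ∃ e ∈ p.edges, wH e ≤ f S := by
    intro s t p S hs ht
    obtain ⟨d, hd, hd1, hd2⟩ := p.exists_boundary_dart (S : Set V) hs ht
    refine ⟨d.edge, List.mem_map_of_mem hd, ?_⟩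
    change wH s(d.fst, d.snd) ≤ f S
    rw [hwH d.adj]
    exact h.side_le d.adj trivial hd1 hd2
  have hmain : ∀ {s t : V} {p : H.Walk s t}, p.IsPath → ∀ e ∈ p.edges,
      (∀ e' ∈ p.edges, wH e ≤ wH e') → IsLeast (separatingValues f s t) (wH e) := by
    intro s t p hp e he hmin
    refine ⟨⟨edgeSide H e s, mem_edgeSide.mpr (SimpleGraph.Reachable.refl _), hcut hp e he⟩, ?_⟩
    rintro _ ⟨S, hs, ht, rfl⟩
    obtain ⟨e', he', hle⟩ := hlower p S hs ht
    exact (hmin e' he').trans hle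
  refine ⟨H, wH, htree, ?_, ?_⟩
  · intro s t hst p hp
    obtain ⟨e, he, hmin⟩ := Finset.exists_min_image p.edges.toFinset wH (by
      obtain ⟨e, he, -⟩ := hlower p {s} (by simp) (by simpa using hst.symm)
      exact ⟨e, by simpa using he⟩)
    simp only [List.mem_toFinset] at he hmin
    refine ⟨wH e, ⟨⟨e, he, rfl⟩, ?_⟩, hmain hp e he hmin⟩
    rintro _ ⟨e', he', rfl⟩
    exact hmin e' he'
  · intro s t _ p hp e he hmin
    rw [(hcut hp e he).2]
    exact ⟨(hcut hp e he).1, hmain hp e he hmin⟩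

end CutTree

/-! ### Cuts and coverage of partitions -/

section Cost

/-- The pairs that leave `S`. -/
def cutEdges {V : Type*} (S : Finset V) : Set (Sym2 V) :=
  {e | (∃ u ∈ S, u ∈ e) ∧ ∃ v ∉ S, v ∈ e}

/-- The pairs that meet `S`. -/
def coveredEdges {V : Type*} (S : Finset V) : Set (Sym2 V) :=
  {e | ∃ v ∈ S, v ∈ e}

theorem mem_cutEdges {V : Type*} {S : Finset V} {a b : V} :
    s(a, b) ∈ cutEdges S ↔ (a ∈ S ∧ b ∉ S) ∨ (b ∈ S ∧ a ∉ S) := by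
  simp only [cutEdges, Set.mem_ofPred_eq, Sym2.mem_iff]
  constructor
  · rintro ⟨⟨u, hu, rfl | rfl⟩, v, hv, rfl | rfl⟩ <;> tauto
  · rintro (⟨h1, h2⟩ | ⟨h1, h2⟩)
    exacts [⟨⟨a, h1, Or.inl rfl⟩, b, h2, Or.inr rfl⟩, ⟨⟨b, h1, Or.inr rfl⟩, a, h2, Or.inl rfl⟩]

theorem mem_coveredEdges {V : Type*} {S : Finset V} {a b : V} :
    s(a, b) ∈ coveredEdges S ↔ a ∈ S ∨ b ∈ S := by
  simp only [coveredEdges, Set.mem_ofPred_eq, Sym2.mem_iff]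
  constructor
  · rintro ⟨u, hu, rfl | rfl⟩ <;> tauto
  · rintro (h | h)
    exacts [⟨a, h, Or.inl rfl⟩, ⟨b, h, Or.inr rfl⟩]

theorem indicator_nonneg_of_mem_edgeSet {V : Type*} {G : SimpleGraph V} {w : Sym2 V → ℝ}
    (hw : ∀ e ∈ G.edgeSet, 0 ≤ w e) {e : Sym2 V} (he : e ∈ G.edgeSet) (D : Set (Sym2 V)) :
    0 ≤ D.indicator w e :=
  Set.indicator_apply_nonneg fun _ => hw e he

variable {V : Type*} [Fintype V] {G : SimpleGraph V} {w : Sym2 V → ℝ}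

theorem graphCut_eq_sum_indicator [Fintype G.edgeSet] (S : Finset V) :
    graphCut G w S = ∑ e ∈ G.edgeFinset, (cutEdges S).indicator w e := by
  classical
  rw [graphCut, Finset.sum_filter]
  refine Finset.sum_congr (by congr!) fun e _ => ?_
  simp only [Set.indicator_apply]
  congr!

theorem graphCoverage_eq_sum_indicator [Fintype G.edgeSet] (S : Finset V) :
    graphCoverage G w S = ∑ e ∈ G.edgeFinset, (coveredEdges S).indicator w e := by
  classical
  rw [graphCoverage, Finset.sum_filter]
  refine Finset.sum_congr (by congr!) fun e _ => ?_
  simp only [Set.indicator_apply]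
  congr!

theorem graphCut_nonneg (hw : ∀ e ∈ G.edgeSet, 0 ≤ w e) (S : Finset V) : 0 ≤ graphCut G w S := by
  classical
  rw [graphCut_eq_sum_indicator]
  exact Finset.sum_nonneg fun e he =>
    indicator_nonneg_of_mem_edgeSet hw (SimpleGraph.mem_edgeFinset.mp he) _

variable [DecidableEq V]

theorem graphCut_compl (S : Finset V) : graphCut G w Sᶜ = graphCut G w S := by
  classical
  have : cutEdges Sᶜ = cutEdges S := by
    ext e
    induction e with | h a b =>
    simp only [mem_cutEdges, Finset.mem_compl]
    tauto
  rw [graphCut_eq_sum_indicator, graphCut_eq_sum_indicator, this]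

theorem graphCut_submodular (hw : ∀ e ∈ G.edgeSet, 0 ≤ w e) (S T : Finset V) :
    graphCut G w (S ∩ T) + graphCut G w (S ∪ T) ≤ graphCut G w S + graphCut G w T := by
  classical
  simp only [graphCut_eq_sum_indicator, ← Finset.sum_add_distrib]
  refine Finset.sum_le_sum fun e he => ?_
  have h0 := hw e (SimpleGraph.mem_edgeFinset.mp he)
  induction e with | h a b =>
  simp only [Set.indicator_apply, mem_cutEdges, Finset.mem_inter, Finset.mem_union]
  by_cases h1 : a ∈ S <;> by_cases h2 : b ∈ S <;> by_cases h3 : a ∈ T <;> by_cases h4 : b ∈ T <;>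
    simp [h1, h2, h3, h4, h0]

/-- The pairs contained in no class of `P`. -/
def crossEdges (P : Finpartition (Finset.univ : Finset V)) : Set (Sym2 V) :=
  {e | ∀ A ∈ P.parts, ∃ v ∈ e, v ∉ A}

theorem mem_crossEdges {P : Finpartition (Finset.univ : Finset V)} {a b : V} :
    s(a, b) ∈ crossEdges P ↔ b ∉ P.part a := by
  simp only [crossEdges, Set.mem_ofPred_eq, Sym2.mem_iff]
  constructor
  · intro h hb
    obtain ⟨v, rfl | rfl, hv⟩ := h _ (P.part_mem.mpr (Finset.mem_univ a))
    exacts [hv (P.mem_part_self.mpr (Finset.mem_univ _)), hv hb]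
  · intro h A hA
    by_contra! hc
    exact h (P.part_eq_of_mem hA (hc a (Or.inl rfl)) ▸ hc b (Or.inr rfl))

/-- The total weight of the edges joining different classes of `P`. -/
noncomputable def crossWeight (G : SimpleGraph V) [Fintype G.edgeSet] (w : Sym2 V → ℝ)
    (P : Finpartition (Finset.univ : Finset V)) : ℝ :=
  ∑ e ∈ G.edgeFinset, (crossEdges P).indicator w e

theorem crossWeight_le_sum [Fintype G.edgeSet] (hw : ∀ e ∈ G.edgeSet, 0 ≤ w e)
    (P : Finpartition (Finset.univ : Finset V)) : crossWeight G w P ≤ ∑ e ∈ G.edgeFinset, w e :=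
  Finset.sum_le_sum fun e he =>
    Set.indicator_apply_le' (fun _ => le_rfl) fun _ => hw e (SimpleGraph.mem_edgeFinset.mp he)

theorem Finpartition.sum_ite_mem (P : Finpartition (Finset.univ : Finset V)) (a : V) (c : ℝ) :
    ∑ A ∈ P.parts, (if a ∈ A then c else 0) = c := by
  rw [Finset.sum_eq_single_of_mem (P.part a) (P.part_mem.mpr (Finset.mem_univ a))]
  · simp
  · intro A hA hne
    exact if_neg fun h => hne (P.part_eq_of_mem hA h).symm

theorem Finpartition.sum_ite_mem_and_mem (P : Finpartition (Finset.univ : Finset V)) (a b : V)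
    (w : Sym2 V → ℝ) : ∑ A ∈ P.parts, (if a ∈ A ∧ b ∈ A then w s(a, b) else 0) =
      w s(a, b) - (crossEdges P).indicator w s(a, b) := by
  classical
  rw [Set.indicator_apply, Finset.sum_eq_single_of_mem (P.part a)
    (P.part_mem.mpr (Finset.mem_univ a))]
  · rw [mem_crossEdges]
    by_cases h : b ∈ P.part a <;> simp [h]
  · intro A hA hne
    exact if_neg fun h => hne (P.part_eq_of_mem hA h.1).symm

/-- An edge is covered once if its ends are in the same class, and twice otherwise. -/
theorem partitionCost_graphCoverage [Fintype G.edgeSet]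
    (P : Finpartition (Finset.univ : Finset V)) :
    partitionCost (graphCoverage G w) P = ∑ e ∈ G.edgeFinset, w e + crossWeight G w P := by
  classical
  simp only [partitionCost, graphCoverage_eq_sum_indicator, crossWeight]
  rw [Finset.sum_comm, ← Finset.sum_add_distrib]
  refine Finset.sum_congr rfl fun e _ => ?_
  induction e with | h a b =>
  have key : ∀ A ∈ P.parts, (coveredEdges A).indicator w s(a, b) =
      ((if a ∈ A then w s(a, b) else 0) + if b ∈ A then w s(a, b) else 0) -
        if a ∈ A ∧ b ∈ A then w s(a, b) else 0 := by
    intro A _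
    simp only [Set.indicator_apply, mem_coveredEdges]
    by_cases h1 : a ∈ A <;> by_cases h2 : b ∈ A <;> simp [h1, h2]
  rw [Finset.sum_congr rfl key, Finset.sum_sub_distrib, Finset.sum_add_distrib,
    Finpartition.sum_ite_mem, Finpartition.sum_ite_mem, Finpartition.sum_ite_mem_and_mem]
  ring

/-- An edge joining different classes leaves exactly two classes. -/
theorem partitionCost_graphCut [Fintype G.edgeSet] (P : Finpartition (Finset.univ : Finset V)) :
    partitionCost (graphCut G w) P = 2 * crossWeight G w P := by
  classical
  simp only [partitionCost, graphCut_eq_sum_indicator, crossWeight]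
  rw [Finset.sum_comm, Finset.mul_sum]
  refine Finset.sum_congr rfl fun e _ => ?_
  induction e with | h a b =>
  have key : ∀ A ∈ P.parts, (cutEdges A).indicator w s(a, b) =
      ((if a ∈ A then w s(a, b) else 0) + if b ∈ A then w s(a, b) else 0) -
        2 * if a ∈ A ∧ b ∈ A then w s(a, b) else 0 := by
    intro A _
    simp only [Set.indicator_apply, mem_cutEdges]
    by_cases h1 : a ∈ A <;> by_cases h2 : b ∈ A <;> simp [h1, h2]
    ring
  rw [Finset.sum_congr rfl key, Finset.sum_sub_distrib, Finset.sum_add_distrib, ← Finset.mul_sum,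
    Finpartition.sum_ite_mem, Finpartition.sum_ite_mem, Finpartition.sum_ite_mem_and_mem]
  ring

end Cost

/-! ### The greedy loop on a Gomory-Hu tree -/

section Greedy

variable {V : Type*} [Fintype V]

theorem IsGomoryHuTree.isLeast_weight {f : Finset V → ℝ} {H : SimpleGraph V} {wH : Sym2 V → ℝ}
    (h : IsGomoryHuTree f H wH) {x y : V} (hxy : H.Adj x y) :
    IsLeast (separatingValues f x y) (wH s(x, y)) := by
  obtain ⟨m, hm1, hm2⟩ := h.min_eq x y hxy.ne hxy.toWalk (SimpleGraph.Walk.IsPath.of_adj hxy)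
  have : wH s(x, y) = m := by simpa [eq_comm] using hm1.1
  rwa [this]

theorem IsGomoryHuTree.apply_edgeSide {f : Finset V → ℝ} {H : SimpleGraph V} {wH : Sym2 V → ℝ}
    (h : IsGomoryHuTree f H wH) {x y : V} (hxy : H.Adj x y) :
    f (edgeSide H s(x, y) x) = wH s(x, y) :=
  (h.cut_attains x y hxy.ne hxy.toWalk (SimpleGraph.Walk.IsPath.of_adj hxy) s(x, y) (by simp)
    (by simp)).2.unique (h.isLeast_weight hxy)

variable [DecidableEq V]

theorem mem_part_componentPartition {G : SimpleGraph V} {a b : V} :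
    b ∈ (componentPartition G).part a ↔ G.Reachable a b := by
  classical
  exact Finpartition.mem_part_ofSetoid_iff_rel

/-- Every edge of `G` joining different components of `H - C` lies in the fundamental cut of some
edge of `C`. -/
theorem crossWeight_componentPartition_le {G : SimpleGraph V} [Fintype G.edgeSet]
    {w : Sym2 V → ℝ} (hw : ∀ e ∈ G.edgeSet, 0 ≤ w e) {H : SimpleGraph V} {wH : Sym2 V → ℝ}
    (hH : IsGomoryHuTree (graphCut G w) H wH) {C : Finset (Sym2 V)}
    (hC : (C : Set (Sym2 V)) ⊆ H.edgeSet) :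
    crossWeight G w (componentPartition (H.deleteEdges (C : Set (Sym2 V)))) ≤ ∑ c ∈ C, wH c := by
  classical
  have hside : ∀ c ∈ C, wH c = graphCut G w (edgeSide H c c.out.1) := by
    intro c hc
    have hcH := hC hc
    have hout : s(c.out.1, c.out.2) = c := c.out_eq
    have hadj : H.Adj c.out.1 c.out.2 := by
      rw [← SimpleGraph.mem_edgeSet, hout]; exact hcH
    have := hH.apply_edgeSide hadj
    rw [hout] at this
    exact this.symm
  rw [Finset.sum_congr rfl hside]
  simp only [graphCut_eq_sum_indicator, crossWeight]
  rw [Finset.sum_comm]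
  refine Finset.sum_le_sum fun e he => ?_
  have hnonneg := indicator_nonneg_of_mem_edgeSet hw (SimpleGraph.mem_edgeFinset.mp he)
  refine Set.indicator_apply_le' (fun hcross => ?_) fun _ => Finset.sum_nonneg fun _ _ => hnonneg _
  induction e with | h a b =>
  rw [mem_crossEdges, mem_part_componentPartition] at hcross
  obtain ⟨p, hp⟩ := (hH.isTree.connected.preconnected a b).exists_isPath
  obtain ⟨c, hcp, hcC⟩ := p.exists_mem_edges_of_not_reachable hcross
  have hcn := hH.isTree.isAcyclic.not_reachable_deleteEdges hp hcp (Set.mem_singleton c)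
  have hout : s(c.out.1, c.out.2) = c := c.out_eq
  refine le_trans (le_of_eq ?_) (Finset.single_le_sum
    (f := fun c => (cutEdges (edgeSide H c c.out.1)).indicator w s(a, b))
    (fun _ _ => hnonneg _) hcC)
  refine (Set.indicator_of_mem ?_ w).symm
  rw [mem_cutEdges]
  simp only [mem_edgeSide]
  rw [← hout] at hcn
  rcases (hH.isTree.connected.preconnected a b).deleteEdges_singleton_ends hcn with h' | h' <;>
    rw [hout] at h' hcn
  · exact Or.inl ⟨h'.1.symm, fun hb => hcn (h'.1.trans hb)⟩
  · exact Or.inr ⟨h'.2.symm, fun ha => hcn (ha.symm.trans h'.2.symm)⟩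

variable {M : Matroid V} {k : ℕ} {H : SimpleGraph V} {wH : Sym2 V → ℝ}

omit [DecidableEq V] in
theorem empty_mem_transversalFamily (hH : H.IsTree) (hk : 1 ≤ k) (hrank : M.eRank = k) :
    ∅ ∈ transversalFamily M H := by
  obtain ⟨B, hB⟩ := M.exists_isBase
  have hcard : B.encard = k := by rw [hB.encard_eq_eRank, hrank]
  obtain ⟨b, hb⟩ : B.Nonempty := by
    rw [← Set.encard_pos, hcard]
    exact_mod_cast hk
  refine (mem_transversalFamily_iff hH).mpr ⟨by simp, {b}, ?_, by simp, by simp⟩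
  exact hB.indep.subset (by simpa using hb)

theorem GreedyRun.card_eq_and_le_and_mem (hH : H.IsTree) (hk : 1 ≤ k) (hrank : M.eRank = k) {n : ℕ}
    {C : Finset (Sym2 V)} (h : GreedyRun M k H wH n C) :
    C.card = n ∧ n ≤ k - 1 ∧ C ∈ transversalFamily M H := by
  induction h with
  | start => exact ⟨rfl, Nat.zero_le _, empty_mem_transversalFamily hH hk hrank⟩
  | @step n C e _ hlt he _ ih =>
    refine ⟨?_, ?_, he.2.2⟩
    · rw [Finset.card_insert_of_notMem he.2.1, ih.1]
    · omega

/-- The loop does not get stuck: augment by a base, all of whose vertices are separated when every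
edge of the tree is deleted. -/
theorem GreedyRun.exists_min_candidate (hH : H.IsTree) (hk : 1 ≤ k) (hrank : M.eRank = k) {n : ℕ}
    {C : Finset (Sym2 V)} (h : GreedyRun M k H wH n C) (hlt : C.card < k - 1) :
    ∃ e ∈ greedyCandidates M H C, ∀ e' ∈ greedyCandidates M H C, wH e ≤ wH e' := by
  obtain ⟨-, -, hC⟩ := h.card_eq_and_le_and_mem hH hk hrank
  obtain ⟨B, hB⟩ := M.exists_isBase
  lift B to Finset V using B.toFinite
  have hcard : B.card = k := by
    have := hB.encard_eq_eRank
    rw [hrank, Set.encard_coe_eq_coe_finsetCard] at this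
    exact_mod_cast this
  obtain ⟨e, -, he⟩ := exists_mem_greedyCandidates hH hC (Y := Set.univ) hB.indep (by omega) (by
    intro x _ y _ hxy
    have hbot : H.deleteEdges Set.univ = ⊥ := by
      ext; simp
    rw [hbot] at hxy
    exact SimpleGraph.reachable_bot.mp hxy)
  exact Set.exists_min_image _ wH (Set.toFinite _) ⟨e, he⟩

theorem exists_greedyRun (hH : H.IsTree) (hk : 1 ≤ k) (hrank : M.eRank = k) {n : ℕ}
    (hn : n ≤ k - 1) : ∃ C, GreedyRun M k H wH n C := by
  induction n with
  | zero => exact ⟨∅, GreedyRun.start⟩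
  | succ n ih =>
    obtain ⟨C, hC⟩ := ih (by omega)
    have hlt : C.card < k - 1 := by
      have := (hC.card_eq_and_le_and_mem hH hk hrank).1
      omega
    obtain ⟨e, he, hmin⟩ := hC.exists_min_candidate hH hk hrank hlt
    exact ⟨_, hC.step hlt he hmin⟩

/-- If the classes of a feasible partition are listed by increasing value, then each greedy edge
weighs at most the value of the class with the same index: the edges of the tree that leave one of
the first `n + 1` classes separate `n + 2` independent vertices, so one of them is a candidate after
`n` steps. -/
theorem GreedyRun.sum_weight_le {f : Finset V → ℝ} (hH : IsGomoryHuTree f H wH) (hk : 1 ≤ k)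
    (hrank : M.eRank = k) {Q : Finpartition (Finset.univ : Finset V)} {B : Set V} (hB : M.Indep B)
    (hBQ : ∀ A ∈ Q.parts, (B ∩ (A : Set V)).ncard = 1) {a : ℕ → Finset V}
    (ha : ∀ i < k, a i ∈ Q.parts) (hainj : ∀ i < k, ∀ j < k, a i = a j → i = j)
    (hmono : ∀ i j, i ≤ j → j < k → f (a i) ≤ f (a j)) {n : ℕ}
    {C : Finset (Sym2 V)} (h : GreedyRun M k H wH n C) :
    ∑ e ∈ C, wH e ≤ ∑ i ∈ Finset.range n, f (a i) := by
  induction h with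
  | start => simp
  | @step n C e hrun hlt he hmin ih =>
    obtain ⟨hcard, -, hC⟩ := hrun.card_eq_and_le_and_mem hH.isTree hk hrank
    rw [Finset.sum_insert he.2.1, Finset.sum_range_succ, add_comm]
    refine add_le_add ih ?_
    -- `b i` is the element of the base in the class `a i`.
    have hrep : ∀ i, ∃ b, i < k → b ∈ B ∧ b ∈ a i := by
      intro i
      by_cases hi : i < k
      · obtain ⟨b, hb⟩ := Set.ncard_eq_one.mp (hBQ _ (ha i hi))
        have : b ∈ B ∩ (a i : Set V) := hb ▸ Set.mem_singleton b
        exact ⟨b, fun _ => this⟩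
      · have := hH.isTree.connected.nonempty
        exact ⟨Classical.arbitrary V, fun h => absurd h hi⟩
    choose b hb using hrep
    have hbn : ∀ i j, i < k → j < k → i ≠ j → b j ∉ a i := by
      intro i j hi hj hij hmem
      exact hij (hainj i hi j hj (Q.eq_of_mem_parts (ha i hi) (ha j hj) hmem (hb j hj).2))
    -- The pairs that leave one of the first `n + 1` classes.
    let Y : Set (Sym2 V) := {e | ∃ x y, e = s(x, y) ∧ ∃ i ≤ n, x ∈ a i ∧ y ∉ a i}
    have hstay : ∀ i ≤ n, ∀ x y, x ∈ a i → y ∉ a i → ¬ (H.deleteEdges Y).Reachable x y := by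
      rintro i hi x y hx hy ⟨p⟩
      obtain ⟨d, -, hd1, hd2⟩ := p.exists_boundary_dart (a i : Set V) hx hy
      have hd := d.adj
      rw [SimpleGraph.deleteEdges_adj] at hd
      exact hd.2 ⟨_, _, rfl, i, hi, hd1, hd2⟩
    have hsep : ∀ i j, i < n + 2 → j < n + 2 → i ≠ j →
        ¬ (H.deleteEdges Y).Reachable (b i) (b j) := by
      intro i j hi hj hij hr
      have hik : i < k := by omega
      have hjk : j < k := by omega
      -- At least one of the two distinct indices is at most `n`.
      rcases (by omega : i ≤ n ∨ j ≤ n) with h | h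
      · exact hstay i h _ _ (hb i hik).2 (hbn i j hik hjk hij) hr
      · exact hstay j h _ _ (hb j hjk).2 (hbn j i hjk hik hij.symm) hr.symm
    have hJcard : ((Finset.range (n + 2)).image b).card = n + 2 := by
      rw [Finset.card_image_of_injOn, Finset.card_range]
      intro i hi j hj hij
      by_contra hne
      refine hsep i j (by simpa using hi) (by simpa using hj) hne ?_
      rw [hij]
    obtain ⟨e', ⟨x, y, rfl, i, hi, hx, hy⟩, hcand⟩ :=
      exists_mem_greedyCandidates hH.isTree hC (Y := Y) (J := (Finset.range (n + 2)).image b)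
        (hB.subset (by
          intro z hz
          obtain ⟨i, hi, rfl⟩ := Finset.mem_image.mp (Finset.mem_coe.mp hz)
          exact (hb i (by rw [Finset.mem_range] at hi; omega)).1))
        (by rw [hJcard]; omega) (by
          intro x hx y hy hxy
          obtain ⟨i, hi, rfl⟩ := Finset.mem_image.mp hx
          obtain ⟨j, hj, rfl⟩ := Finset.mem_image.mp hy
          by_contra hne
          exact hsep i j (Finset.mem_range.mp hi) (Finset.mem_range.mp hj)
            (fun h => hne (h ▸ rfl)) hxy)
    calc wH e ≤ wH s(x, y) := hmin _ hcand
      _ ≤ f (a i) := (hH.isLeast_weight hcand.1).2 ⟨a i, hx, hy, rfl⟩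
      _ ≤ f (a n) := hmono i n hi (by omega)

/-- The weight of the greedy edge set is at most the total value of any feasible partition. -/
theorem GreedyRun.sum_weight_le_partitionCost {f : Finset V → ℝ} (hf : ∀ S, 0 ≤ f S)
    (hH : IsGomoryHuTree f H wH) (hk : 1 ≤ k) (hrank : M.eRank = k)
    {Q : Finpartition (Finset.univ : Finset V)} (hQ : IsFeasiblePartition M k Q) {n : ℕ}
    {C : Finset (Sym2 V)} (h : GreedyRun M k H wH n C) :
    ∑ e ∈ C, wH e ≤ partitionCost f Q := by
  obtain ⟨hQk, B, hB, hBQ⟩ := hQ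
  let g : Fin k ≃ Q.parts := (Q.parts.equivFinOfCardEq hQk).symm
  let σ : Equiv.Perm (Fin k) := Tuple.sort fun i => f (g i)
  let a : ℕ → Finset V := fun i => if hi : i < k then g (σ ⟨i, hi⟩) else ∅
  have ha' : ∀ (i : ℕ) (hi : i < k), a i = g (σ ⟨i, hi⟩) := fun i hi => dif_pos hi
  have hsum : partitionCost f Q = ∑ i ∈ Finset.range k, f (a i) := by
    rw [partitionCost, ← Finset.sum_coe_sort, ← (σ.trans g).sum_comp, Finset.sum_range]
    refine Finset.sum_congr rfl fun i _ => ?_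
    rw [ha' i i.2]
    rfl
  obtain ⟨-, hn, -⟩ := h.card_eq_and_le_and_mem hH.isTree hk hrank
  rw [hsum]
  refine (h.sum_weight_le hH hk hrank hB.indep hBQ (a := a) ?_ ?_ ?_).trans ?_
  · intro i hi
    rw [ha' i hi]
    exact (g (σ ⟨i, hi⟩)).2
  · intro i hi j hj hij
    rw [ha' i hi, ha' j hj] at hij
    simpa using hij
  · intro i j hij hj
    rw [ha' i (by omega), ha' j hj]
    exact Tuple.monotone_sort (fun i => f (g i)) (Fin.mk_le_mk.mpr hij)
  · refine Finset.sum_le_sum_of_subset_of_nonneg ?_ fun i _ _ => hf _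
    intro i hi
    rw [Finset.mem_range] at hi ⊢
    omega

/-- The components of `H - C` form a feasible partition if `C` is a member of the transversal family
of the largest possible size. -/
theorem isFeasiblePartition_componentPartition (hH : H.IsTree) (hk : 1 ≤ k) (hrank : M.eRank = k)
    {C : Finset (Sym2 V)} (hC : C ∈ transversalFamily M H) (hcard : C.card = k - 1) :
    IsFeasiblePartition M k (componentPartition (H.deleteEdges (C : Set (Sym2 V)))) := by
  obtain ⟨hCH, I, hI, hIc⟩ := hC
  set G := H.deleteEdges (C : Set (Sym2 V))
  lift I to Finset V using I.toFinite
  have hIk : I.card = k := by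
    have := ((SimpleGraph.forall_ncard_inter_supp_eq_one_iff I).mp hIc).1
    rw [hH.card_connectedComponent_deleteEdges C hCH] at this
    omega
  have hbase : M.IsBase (I : Set V) := by
    obtain ⟨B, hB, hIB⟩ := hI.exists_isBase_superset
    have : (I : Set V) = B := by
      refine Set.Finite.eq_of_subset_of_encard_le (Set.toFinite _) hIB ?_
      rw [hB.encard_eq_eRank, hrank, Set.encard_coe_eq_coe_finsetCard, hIk]
    rwa [this]
  have hmeet : ∀ A ∈ (componentPartition G).parts, ((I : Set V) ∩ (A : Set V)).ncard = 1 := by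
    intro A hA
    obtain ⟨v, hv⟩ := (componentPartition G).nonempty_of_mem_parts hA
    have hAv : (A : Set V) = (G.connectedComponentMk v).supp := by
      ext x
      rw [← (componentPartition G).part_eq_of_mem hA hv, Finset.mem_coe,
        mem_part_componentPartition, SimpleGraph.ConnectedComponent.mem_supp_iff,
        SimpleGraph.ConnectedComponent.eq]
      exact ⟨fun h => h.symm, fun h => h.symm⟩
    rw [hAv]
    exact hIc _
  refine ⟨?_, I, hbase, hmeet⟩
  rw [← hIk]
  symm
  refine Finset.card_bij (fun x _ => (componentPartition G).part x)
    (fun x _ => (componentPartition G).part_mem.mpr (Finset.mem_univ x)) ?_ ?_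
  · intro x hx y hy hxy
    have hy' : y ∈ (componentPartition G).part x := by
      rw [hxy]
      exact (componentPartition G).mem_part_self.mpr (Finset.mem_univ y)
    exact ((SimpleGraph.forall_ncard_inter_supp_eq_one_iff I).mp hIc).2 x hx y hy
      (mem_part_componentPartition.mp hy')
  · intro A hA
    obtain ⟨x, hx⟩ := Set.ncard_eq_one.mp (hmeet A hA)
    have hx' : x ∈ (I : Set V) ∩ (A : Set V) := hx ▸ Set.mem_singleton x
    exact ⟨x, hx'.1, (componentPartition G).part_eq_of_mem hA hx'.2⟩

end Greedy

/-- The Gomory-Hu tree algorithm, run on the cut function of the weighted graph `(G, w)` and the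
rank-`k` matroid `M`, is a `4/3`-approximation for matroid-constrained partitioning with the graph
coverage function of `(G, w)`: the Gomory-Hu tree exists, the greedy loop never gets stuck and stops
after at most `k - 1` iterations, and each possible output is a feasible partition whose cost is at
most `4/3` times the cost of any feasible partition. -/
theorem mainTheorem5 {V : Type*} [Fintype V] [DecidableEq V] (G : SimpleGraph V)
    (w : Sym2 V → ℝ) (hw : ∀ e ∈ G.edgeSet, 0 ≤ w e) (M : Matroid V) (hM : M.E = Set.univ)
    (k : ℕ) (hk : 1 ≤ k) (hrank : M.eRank = k) :
    (∃ (H : SimpleGraph V) (wH : Sym2 V → ℝ), IsGomoryHuTree (graphCut G w) H wH) ∧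
    (∀ (H : SimpleGraph V) (wH : Sym2 V → ℝ), IsGomoryHuTree (graphCut G w) H wH →
      ∀ (n : ℕ) (C : Finset (Sym2 V)), GreedyRun M k H wH n C →
        n ≤ k - 1 ∧
        (C.card < k - 1 → ∃ e ∈ greedyCandidates M H C,
          ∀ e' ∈ greedyCandidates M H C, wH e ≤ wH e')) ∧
    (∃ P, IsGomoryHuOutput (graphCut G w) M k P) ∧
    ∀ P, IsGomoryHuOutput (graphCut G w) M k P →
      IsFeasiblePartition M k P ∧
      ∀ Q, IsFeasiblePartition M k Q →
        partitionCost (graphCoverage G w) P ≤ 4 / 3 * partitionCost (graphCoverage G w) Q := by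

  classical
  obtain ⟨B, hB⟩ := M.exists_isBase
  have hV : Nonempty V := by
    have hcard : B.encard = k := by rw [hB.encard_eq_eRank, hrank]
    obtain ⟨b, -⟩ : B.Nonempty := by
      rw [← Set.encard_pos, hcard]
      exact_mod_cast hk
    exact ⟨b⟩
  have hGH : ∃ (H : SimpleGraph V) (wH : Sym2 V → ℝ), IsGomoryHuTree (graphCut G w) H wH :=
    exists_isGomoryHuTree graphCut_compl (graphCut_submodular hw)
  refine ⟨hGH, ?_, ?_, ?_⟩
  · intro H wH hH n C hrun
    exact ⟨(hrun.card_eq_and_le_and_mem hH.isTree hk hrank).2.1,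
      hrun.exists_min_candidate hH.isTree hk hrank⟩
  · obtain ⟨H, wH, hH⟩ := hGH
    obtain ⟨C, hC⟩ := exists_greedyRun (wH := wH) hH.isTree hk hrank le_rfl
    have := (hC.card_eq_and_le_and_mem hH.isTree hk hrank).1
    exact ⟨_, H, wH, hH, _, C, hC, by omega, rfl⟩
  · rintro P ⟨H, wH, hH, n, C, hrun, hfinal, rfl⟩
    obtain ⟨hcard, hn, hC⟩ := hrun.card_eq_and_le_and_mem hH.isTree hk hrank
    refine ⟨isFeasiblePartition_componentPartition hH.isTree hk hrank hC (by omega), ?_⟩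
    intro Q hQ
    have h1 := crossWeight_componentPartition_le hw hH hC.1
    have h2 := hrun.sum_weight_le_partitionCost (graphCut_nonneg hw) hH hk hrank hQ
    rw [partitionCost_graphCut] at h2
    rw [partitionCost_graphCoverage, partitionCost_graphCoverage]
    -- With `W` the total weight and `x`, `y` the weights of the edges crossing `Q` and the output,
    -- `y ≤ 2 x` and `y ≤ W` give `3 (W + y) = 3 W + y + 2 y ≤ 3 W + W + 4 x`.
    have h3 := crossWeight_le_sum hw
      (componentPartition (H.deleteEdges (C : Set (Sym2 V))))
    linarith
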